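/- Let $n\ge 1$ and let $r:\mathbb R^n\to(0,\infty)$ be $C^\infty$ with $|\nabla r(y)|\neq 1$ for all $y\in\mathbb R^n$. Let $R$ be the spherical transform $$Rf(y)=\int_{S(y)} f\,dS,\qquad S(y)=\{x\in\mathbb R^n:\ |x-y|=r(y)\},\qquad f\in\mathcal D(\mathbb R^n)=C_c^\infty(\mathbb R^n),$$ where $dS$ is the surface measure of $S(y)$. For each such $f$ the function $Rf$ is locally integrable, and $R$ is regarded as an operator $\mathcal D(\mathbb R^n)\to\mathcal D'(\mathbb R^n)$. **Definitions.** Let $Y\subset\mathbb R^{n_Y}$ and $X\subset\mathbb R^{n_X}$ be open and $N\ge1$. - A *phase function* is a $C^\infty$ function $\Phi:Y\times X\times(\mathbb R^N\setminus 0)\to\mathbb R$, positively homogeneous of degree one in $\sigma$, with $d\Phi$ nowhere zero. Its critical set is $\Sigma_\Phi=\{d_\sigma\Phi=0\}$. It is *clean* if $\Sigma_\Phi$ is a smooth submanifold whose tangent space at every point is $\ker d(d_\sigma\Phi)$, and *nondegenerate* if $d_y\Phi$ and $d_x\Phi$ never vanish on $\Sigma_\Phi$. Its *canonical relation* is $\mathcal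 C=\{(y,d_y\Phi;\,x,-d_x\Phi):(y,x,\sigma)\in\Sigma_\Phi\}$, with cotangent spaces identified with Euclidean spaces. - A *symbol of order $m$* is $a\in C^\infty(Y\times X\times\mathbb R^N)$ such that for every compact $K\subset Y\times X$ and all multi-indices $\alpha,\beta,\gamma$ there is a constant $C$ with $|\partial_y^\gamma\partial_x^\beta\partial_\sigma^\alpha a(y,x,\sigma)|\le C(1+|\sigma|)^{m-|\alpha|}$ for $(y,x)\in K$, $\sigma\in\mathbb R^N$. It is *elliptic* if for every compact $K\subset Y\times X$ there are $C,M>0$ with $|a(y,x,\sigma)|\ge C(1+|\sigma|)^m$ for $(y,x)\in K$, $|\sigma|\ge M$. - An operator $A:\mathcal D(X)\to\mathcal D'(Y)$ is an *elliptic Fourier integral operator (FIO) of order $m+\frac N2-\frac{n_X+n_Y}4$ with phase $\Phi$* if $\Phi$ is a clean nondegenerate phase function and $A$ has a Schwartz kernel given by the oscillatory integral $K_A(y,x)=\int_{\mathbb R^N}e^{i\Phi(y,x,\sigma)}a(y,x,\sigma)\,d\sigma$ for some elliptic symbol $a$ of order $m$; that is, for every $\chi\in C_c^\infty(\mathbb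 R^N)$ with $\chi=1$ near $0$ and every $u\in\mathcal D(Y\times X)$, $$\langle K_A,u\rangle=\lim_{\varepsilon\to0^+}\iiint e^{i\Phi}\,a\,\chi(\varepsilon\sigma)\,u(y,x)\,dy\,dx\,d\sigma .$$ The canonical relation of $A$ is that of $\Phi$. **Proposition.** $R$ is an elliptic FIO of order $-(n-1)/2$ with phase $$\Phi(y,x,\sigma)=\sigma\left(|x-y|^2-r(y)^2\right),\qquad \sigma\in\mathbb R\setminus 0 .$$ Moreover, global coordinates on the canonical relation $\mathcal C$ of $R$ are given by $$\mathbb R^n\times S^{n-1}\times(\mathbb R\setminus0)\ni(y,\omega,\sigma)\mapsto\Big(y,\,-2\sigma r(y)\big(\omega+\nabla r(y)\big);\ y+r(y)\omega,\,-2\sigma r(y)\omega\Big),$$ that is, this map is a smooth embedding into $\mathbb R^{4n}$ (smooth, with injective differentials, and a homeomorphism onto its image) with image $\mathcal C$. -/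

import Mathlib

open Set Filter Topology MeasureTheory
open scoped Manifold ContDiff Distributions Gradient

noncomputable section

namespace SphericalMicrolocal

/-- The Euclidean space `ℝᵏ`. -/
abbrev Eucl (k : ℕ) : Type := EuclideanSpace ℝ (Fin k)

instance factFinrankEucl (n : ℕ) [NeZero n] :
    Fact (Module.finrank ℝ (Eucl n) = (n - 1) + 1) :=
  ⟨by rw [finrank_euclideanSpace_fin]; have := NeZero.pos n; omega⟩

/-! ### Distributions, operators and Schwartz kernels -/

/-- The space `𝒟'(X)` of complex-valued distributions on an open set `X`: continuous
`ℂ`-linear functionals on the complex-valued test functions `𝒟(X)`. -/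
abbrev Distr {E : Type*} [NormedAddCommGroup E] [NormedSpace ℝ E]
    (X : TopologicalSpace.Opens E) : Type _ :=
  𝓓(X, ℂ) →L[ℂ] ℂ

/-- The open set `Y × X`. -/
def openProd {E F : Type*} [TopologicalSpace E] [TopologicalSpace F]
    (Y : TopologicalSpace.Opens E) (X : TopologicalSpace.Opens F) :
    TopologicalSpace.Opens (E × F) :=
  ⟨(Y : Set E) ×ˢ (X : Set F), Y.isOpen.prod X.isOpen⟩

/-- The test function `(y, x) ↦ g y * f x` on `Y × X`. -/
def tensor {E F : Type*} [NormedAddCommGroup E] [NormedSpace ℝ E]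
    [NormedAddCommGroup F] [NormedSpace ℝ F]
    {Y : TopologicalSpace.Opens E} {X : TopologicalSpace.Opens F}
    (g : 𝓓(Y, ℂ)) (f : 𝓓(X, ℂ)) : 𝓓(openProd Y X, ℂ) where
  toFun p := g p.1 * f p.2
  contDiff' := (g.contDiff.comp contDiff_fst).mul (f.contDiff.comp contDiff_snd)
  hasCompactSupport' := by
    refine HasCompactSupport.intro (g.hasCompactSupport.isCompact.prod
      f.hasCompactSupport.isCompact) (fun p hp => ?_)
    by_cases h : p.1 ∈ tsupport g
    · rw [image_eq_zero_of_notMem_tsupport (f := f) (fun h2 => hp ⟨h, h2⟩), mul_zero]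
    · rw [image_eq_zero_of_notMem_tsupport h, zero_mul]
  tsupport_subset' := by
    have h : tsupport (fun p : E × F => g p.1 * f p.2) ⊆ tsupport g ×ˢ tsupport f := by
      refine closure_minimal (fun p hp => ?_) ((isClosed_tsupport g).prod (isClosed_tsupport f))
      exact ⟨subset_tsupport g (left_ne_zero_of_mul hp),
        subset_tsupport f (right_ne_zero_of_mul hp)⟩
    exact fun p hp => ⟨g.tsupport_subset (h hp).1, f.tsupport_subset (h hp).2⟩

/-- `K ∈ 𝒟'(Y × X)` is the Schwartz kernel of `A : 𝒟(X) → 𝒟'(Y)`, that is,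
`⟨A f, g⟩ = ⟨K, g ⊗ f⟩`. -/
def IsSchwartzKernel {E F : Type*} [NormedAddCommGroup E] [NormedSpace ℝ E]
    [NormedAddCommGroup F] [NormedSpace ℝ F]
    {Y : TopologicalSpace.Opens E} {X : TopologicalSpace.Opens F}
    (A : 𝓓(X, ℂ) →ₗ[ℂ] Distr Y) (K : Distr (openProd Y X)) : Prop :=
  ∀ (f : 𝓓(X, ℂ)) (g : 𝓓(Y, ℂ)), A f g = K (tensor g f)

/-- `A : 𝒟(X) → 𝒟'(Y)` is the operator given by the function-valued transform `T`: every `T f`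
is a locally integrable function on `Y`, and `A f` is the distribution it defines.
(The test function `g` vanishes outside `Y`.) -/
def IsOperatorOf {nX nY : ℕ} {X : TopologicalSpace.Opens (Eucl nX)}
    {Y : TopologicalSpace.Opens (Eucl nY)}
    (A : 𝓓(X, ℂ) →ₗ[ℂ] Distr Y) (T : (Eucl nX → ℂ) → Eucl nY → ℂ) : Prop :=
  ∀ f : 𝓓(X, ℂ), LocallyIntegrableOn (T f) (Y : Set (Eucl nY)) ∧
    ∀ g : 𝓓(Y, ℂ), A f g = ∫ y, T f y * g y

/-! ### Submanifolds of a normed space -/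

section Submanifold

variable {E : Type*} [NormedAddCommGroup E] [NormedSpace ℝ E]

/-- `e` is a smooth chart of the ambient space that straightens `M` to the linear subspace `V`. -/
def IsSliceChart (M : Set E) (e : OpenPartialHomeomorph E E) (V : Submodule ℝ E) : Prop :=
  ContDiffOn ℝ ∞ e e.source ∧ ContDiffOn ℝ ∞ e.symm e.target ∧
    ∀ q ∈ e.source, q ∈ M ↔ e q ∈ V

/-- `M` is an embedded smooth submanifold of `E`. -/
def IsSmoothSubmanifold (M : Set E) : Prop :=
  ∀ p ∈ M, ∃ (e : OpenPartialHomeomorph E E) (V : Submodule ℝ E),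
    p ∈ e.source ∧ IsSliceChart M e V

/-- `T` is the tangent space at `p` of the submanifold `M`: the preimage, under the derivative of
a slice chart at `p`, of the subspace to which that chart straightens `M`. -/
def IsTangentSpaceAt (M : Set E) (p : E) (T : Submodule ℝ E) : Prop :=
  ∃ (e : OpenPartialHomeomorph E E) (V : Submodule ℝ E),
    p ∈ e.source ∧ IsSliceChart M e V ∧ T = V.comap (fderiv ℝ e p).toLinearMap

end Submanifold

/-! ### Symbols -/

section Operators

variable {nY nX N : ℕ}

/-- The class `S^m(Y × X, ℝᴺ)`. The norm of the `k`-th derivative in `σ`, then `j`-th derivative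
in `(y, x)`, controls all mixed partial derivatives with these total orders, and conversely. -/
structure IsSymbol (Y : TopologicalSpace.Opens (Eucl nY)) (X : TopologicalSpace.Opens (Eucl nX))
    (m : ℝ) (a : (Eucl nY × Eucl nX) × Eucl N → ℂ) : Prop where
  smooth : ContDiffOn ℝ ∞ a (((Y : Set (Eucl nY)) ×ˢ (X : Set (Eucl nX))) ×ˢ univ)
  bound : ∀ K : Set (Eucl nY × Eucl nX), IsCompact K →
    K ⊆ (Y : Set (Eucl nY)) ×ˢ (X : Set (Eucl nX)) → ∀ j k : ℕ, ∃ C : ℝ, ∀ z ∈ K, ∀ σ : Eucl N,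
      ‖iteratedFDeriv ℝ j (fun w => iteratedFDeriv ℝ k (fun τ => a (w, τ)) σ) z‖
        ≤ C * (1 + ‖σ‖) ^ (m - k)

/-- Ellipticity of a symbol of order `m`. -/
def IsEllipticSymbol (Y : TopologicalSpace.Opens (Eucl nY)) (X : TopologicalSpace.Opens (Eucl nX))
    (m : ℝ) (a : (Eucl nY × Eucl nX) × Eucl N → ℂ) : Prop :=
  ∀ K : Set (Eucl nY × Eucl nX), IsCompact K →
    K ⊆ (Y : Set (Eucl nY)) ×ˢ (X : Set (Eucl nX)) → ∃ C > (0 : ℝ), ∃ M > (0 : ℝ),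
      ∀ z ∈ K, ∀ σ : Eucl N, M ≤ ‖σ‖ → C * (1 + ‖σ‖) ^ m ≤ ‖a (z, σ)‖

/-! ### Phase functions and canonical relations -/

/-- The partial differential `d_y Φ`, as a vector. -/
def dY (Φ : (Eucl nY × Eucl nX) × Eucl N → ℝ) (p : (Eucl nY × Eucl nX) × Eucl N) : Eucl nY :=
  ∇ (fun y => Φ ((y, p.1.2), p.2)) p.1.1

/-- The partial differential `d_x Φ`, as a vector. -/
def dX (Φ : (Eucl nY × Eucl nX) × Eucl N → ℝ) (p : (Eucl nY × Eucl nX) × Eucl N) : Eucl nX :=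
  ∇ (fun x => Φ ((p.1.1, x), p.2)) p.1.2

/-- The partial differential `d_σ Φ`, as a vector. -/
def dSigma (Φ : (Eucl nY × Eucl nX) × Eucl N → ℝ) (p : (Eucl nY × Eucl nX) × Eucl N) : Eucl N :=
  ∇ (fun σ => Φ (p.1, σ)) p.2

/-- The set `Y × X × (ℝᴺ ∖ 0)`. -/
def phaseDomain (Y : TopologicalSpace.Opens (Eucl nY)) (X : TopologicalSpace.Opens (Eucl nX))
    (N : ℕ) : Set ((Eucl nY × Eucl nX) × Eucl N) :=
  ((Y : Set (Eucl nY)) ×ˢ (X : Set (Eucl nX))) ×ˢ {0}ᶜ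

/-- Phase functions on `Y × X × (ℝᴺ ∖ 0)`. -/
structure IsPhase (Y : TopologicalSpace.Opens (Eucl nY)) (X : TopologicalSpace.Opens (Eucl nX))
    (Φ : (Eucl nY × Eucl nX) × Eucl N → ℝ) : Prop where
  smooth : ContDiffOn ℝ ∞ Φ (phaseDomain Y X N)
  homogeneous : ∀ p ∈ phaseDomain Y X N, ∀ t : ℝ, 0 < t → Φ (p.1, t • p.2) = t * Φ p
  fderiv_ne_zero : ∀ p ∈ phaseDomain Y X N, fderiv ℝ Φ p ≠ 0

/-- The critical set `Σ_Φ`. -/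
def criticalSet (Y : TopologicalSpace.Opens (Eucl nY)) (X : TopologicalSpace.Opens (Eucl nX))
    (Φ : (Eucl nY × Eucl nX) × Eucl N → ℝ) : Set ((Eucl nY × Eucl nX) × Eucl N) :=
  {p ∈ phaseDomain Y X N | dSigma Φ p = 0}

/-- Clean phase functions: the critical set is a smooth manifold whose tangent space at every
point is the kernel of `d (d_σ Φ)`. -/
structure IsCleanPhase (Y : TopologicalSpace.Opens (Eucl nY))
    (X : TopologicalSpace.Opens (Eucl nX)) (Φ : (Eucl nY × Eucl nX) × Eucl N → ℝ) : Prop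
    extends IsPhase Y X Φ where
  submanifold : IsSmoothSubmanifold (criticalSet Y X Φ)
  tangent : ∀ p ∈ criticalSet Y X Φ,
    IsTangentSpaceAt (criticalSet Y X Φ) p (fderiv ℝ (dSigma Φ) p).ker

/-- Nondegeneracy: `d_y Φ` and `d_x Φ` never vanish on the critical set. -/
def IsNondegenerate (Y : TopologicalSpace.Opens (Eucl nY)) (X : TopologicalSpace.Opens (Eucl nX))
    (Φ : (Eucl nY × Eucl nX) × Eucl N → ℝ) : Prop :=
  ∀ p ∈ criticalSet Y X Φ, dY Φ p ≠ 0 ∧ dX Φ p ≠ 0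

/-- The canonical relation `{((y, d_y Φ); (x, -d_x Φ)) : (y, x, σ) ∈ Σ_Φ}` parametrized by `Φ`,
inside `T*Y × T*X`, where cotangent spaces are identified with the Euclidean spaces. -/
def canonicalRelation (Y : TopologicalSpace.Opens (Eucl nY))
    (X : TopologicalSpace.Opens (Eucl nX)) (Φ : (Eucl nY × Eucl nX) × Eucl N → ℝ) :
    Set ((Eucl nY × Eucl nY) × (Eucl nX × Eucl nX)) :=
  (fun p => ((p.1.1, dY Φ p), (p.1.2, -dX Φ p))) '' criticalSet Y X Φ

/-! ### Oscillatory integrals and Fourier integral operators -/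

/-- `K(y, x) = ∫ e^{iΦ(y,x,σ)} a(y,x,σ) dσ` as an oscillatory integral: for every smooth compactly
supported cut-off `χ` equal to `1` near `0`, and every test function `u`,
`⟨K, u⟩ = lim_{ε → 0+} ∭ e^{iΦ} a χ(εσ) u dy dx dσ`. (The test function vanishes outside
`Y × X`, so that the integrand is bounded with compact support.) -/
def IsOscillatoryIntegral {Y : TopologicalSpace.Opens (Eucl nY)}
    {X : TopologicalSpace.Opens (Eucl nX)} (Φ : (Eucl nY × Eucl nX) × Eucl N → ℝ)
    (a : (Eucl nY × Eucl nX) × Eucl N → ℂ) (K : Distr (openProd Y X)) : Prop :=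
  ∀ χ : Eucl N → ℝ, ContDiff ℝ ∞ χ → HasCompactSupport χ → (∀ᶠ σ in 𝓝 0, χ σ = 1) →
    ∀ u : 𝓓(openProd Y X, ℂ),
      Tendsto (fun ε : ℝ => ∫ p : (Eucl nY × Eucl nX) × Eucl N,
        Complex.exp (Complex.I * (Φ p : ℂ)) * a p * (χ (ε • p.2) : ℂ) * u p.1)
        (𝓝[>] 0) (𝓝 (K u))

/-- `A` is a Fourier integral operator with phase `Φ` and symbol `a` of order `m`. -/
structure IsFIOWith {Y : TopologicalSpace.Opens (Eucl nY)} {X : TopologicalSpace.Opens (Eucl nX)}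
    (A : 𝓓(X, ℂ) →ₗ[ℂ] Distr Y) (Φ : (Eucl nY × Eucl nX) × Eucl N → ℝ)
    (a : (Eucl nY × Eucl nX) × Eucl N → ℂ) (m : ℝ) : Prop where
  pos : 0 < N
  clean : IsCleanPhase Y X Φ
  nondegenerate : IsNondegenerate Y X Φ
  symbol : IsSymbol Y X m a
  kernel : ∃ K : Distr (openProd Y X), IsSchwartzKernel A K ∧ IsOscillatoryIntegral Φ a K

/-- `A` is an elliptic Fourier integral operator of order `μ` with phase `Φ`. The order of an
operator with symbol of order `m` is `m + N/2 - (n_X + n_Y)/4`. -/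
def IsEllipticFIO {Y : TopologicalSpace.Opens (Eucl nY)} {X : TopologicalSpace.Opens (Eucl nX)}
    (A : 𝓓(X, ℂ) →ₗ[ℂ] Distr Y) (Φ : (Eucl nY × Eucl nX) × Eucl N → ℝ) (μ : ℝ) : Prop :=
  ∃ (m : ℝ) (a : (Eucl nY × Eucl nX) × Eucl N → ℂ),
    IsFIOWith A Φ a m ∧ IsEllipticSymbol Y X m a ∧
      μ = m + (N : ℝ) / 2 - ((nX : ℝ) + (nY : ℝ)) / 4

end Operators

/-! ### The spherical transform -/

variable {n : ℕ}

/-- The surface measure on the sphere in `ℝⁿ` with centre `c` and radius `ρ > 0`: the image of the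
surface measure of the unit sphere under `θ ↦ c + ρ θ`, scaled by `ρ ^ (n - 1)`. -/
def sphereSurfaceMeasure (c : Eucl n) (ρ : ℝ) : Measure (Eucl n) :=
  ENNReal.ofReal (ρ ^ (n - 1)) •
    (volume : Measure (Eucl n)).toSphere.map
      (fun θ : Metric.sphere (0 : Eucl n) 1 => c + ρ • (θ : Eucl n))

/-- The spherical transform `R f (y) = ∫_{S(y)} f dS`, where `S(y)` is the sphere with centre `y`
and radius `r y`. -/
def sphericalTransform (r : Eucl n → ℝ) (f : Eucl n → ℂ) (y : Eucl n) : ℂ :=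
  ∫ x, f x ∂sphereSurfaceMeasure y (r y)

/-- The phase `Φ(y, x, σ) = σ (|x - y|² - r(y)²)`, with one phase variable. -/
def sphericalPhase (r : Eucl n → ℝ) (p : (Eucl n × Eucl n) × Eucl 1) : ℝ :=
  p.2 0 * (‖p.1.2 - p.1.1‖ ^ 2 - r p.1.1 ^ 2)

/-- The open set `ℝ ∖ 0`. -/
def puncturedLine : TopologicalSpace.Opens ℝ := ⟨{0}ᶜ, isOpen_compl_singleton⟩

/-- The map `(y, ω, σ) ↦ ((y, -2σ r(y) (ω + ∇r(y))); (y + r(y) ω, -2σ r(y) ω))`. -/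
def sphericalCoordinates (r : Eucl n → ℝ)
    (q : Eucl n × Metric.sphere (0 : Eucl n) 1 × puncturedLine) :
    (Eucl n × Eucl n) × (Eucl n × Eucl n) :=
  ((q.1, (-2 * (q.2.2 : ℝ) * r q.1) • ((q.2.1 : Eucl n) + ∇ r q.1)),
    (q.1 + r q.1 • (q.2.1 : Eucl n), (-2 * (q.2.2 : ℝ) * r q.1) • (q.2.1 : Eucl n)))

/-- `κ : M → E` is a global parametrization of `C ⊆ E`, so that its inverse gives global
coordinates on `C`: a smooth embedding (a smooth map with injective differentials that is a
homeomorphism onto its image) with image `C`. -/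
structure IsGlobalParametrization {F H M E : Type*} [NormedAddCommGroup F] [NormedSpace ℝ F]
    [TopologicalSpace H] (I : ModelWithCorners ℝ F H) [TopologicalSpace M] [ChartedSpace H M]
    [NormedAddCommGroup E] [NormedSpace ℝ E] (κ : M → E) (C : Set E) : Prop where
  smooth : ContMDiff I 𝓘(ℝ, E) ∞ κ
  immersion : ∀ q : M, Function.Injective (mfderiv I 𝓘(ℝ, E) κ q)
  embedding : IsEmbedding κ
  range_eq : range κ = C

end SphericalMicrolocal

end

open SphericalMicrolocal

/-!
The spherical transform is integration against a delta function:
`∫_{S(y)} f dS = ∫ f(x) 2 r(y) δ(|x - y|² - r(y)²) dx`, and `δ(t) = (2π)⁻¹ ∫ e^{iσt} dσ`. So `R` has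
the symbol `r(y) / π` of order `0` with respect to the phase `σ (|x - y|² - r(y)²)`; with one phase
variable this gives the order `1/2 - n/2`.

*The kernel.* The Schwartz kernel is integration over the incidence relation `x ∈ S(y)`
(`sphericalKernel`). To see that the oscillatory integral converges to it, the cut-off `σ`-integral
is evaluated as `ε⁻¹ φ(-(|x - y|² - r²) / (2πε))`, where `φ` is the Fourier transform of the
cut-off, so that `∫ φ = χ(0) = 1`. In polar coordinates `x = y + sθ`
(`regularized_oscillatoryIntegral`) the substitution `s = r + εv` turns the kernel into
`φ(-v (2r + εv) / 2π)`. Since `2r + εv = r + s ≥ r` for `s > 0`, the decay `|φ(t)| ≤ C / (1 + t²)`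
dominates it independently of `ε`, without a change of variables that is singular at `s = 0`;
dominated convergence, first in `v` (`tendsto_radialIntegral`), then in `(y, θ)`, finishes the proof
(`isOscillatoryIntegral_sphericalKernel`).

*The phase.* The critical set is the part `σ ≠ 0` of the zero set of `|x - y|² - r(y)²`, whose
differential does not vanish there because its `x`-part is `2 (x - y)`. It is straightened by an
explicit chart (`exists_sliceChart_levelSet`). On it `d_x Φ = 2σ (x - y)` and
`d_y Φ = -2σ (x - y + r ∇r)`, and the latter is nonzero because `|x - y| = r` and `|∇r| ≠ 1`.

*The coordinates.* The parametrization of the canonical relation has a smooth left inverse on all of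
`ℝ⁴ⁿ`, namely `ω = (x - y) / r(y)` and `σ = -⟨ξ, x - y⟩ / (2 r(y)²)`
(`sphericalCoordinatesInv_comp`). Composing with it gives the inclusion of the parameter manifold
into `ℝⁿ × ℝⁿ × ℝ`, so injectivity of the differentials and the embedding property follow from those
of the inclusion.
-/

namespace SphericalMicrolocal

/-! ### Regular level sets -/

/-- The chart is `q ↦ q + (g q - L q) • v`, where `L = dg(p)` and `L v = 1`: its derivative at `p`
is the identity, and `L` of it is `g`. -/
lemma exists_sliceChart_levelSet {E : Type*} [NormedAddCommGroup E] [NormedSpace ℝ E]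
    [CompleteSpace E] {g : E → ℝ} (hg : ContDiff ℝ ∞ g) {U : Set E} (hU : IsOpen U) {p : E}
    (hp : p ∈ U) (hL : fderiv ℝ g p ≠ 0) :
    ∃ e : OpenPartialHomeomorph E E, p ∈ e.source ∧
      IsSliceChart {q ∈ U | g q = 0} e (fderiv ℝ g p).ker ∧
      fderiv ℝ e p = ContinuousLinearMap.id ℝ E := by
  set L := fderiv ℝ g p with hLdef
  obtain ⟨w, hw⟩ : ∃ w, L w ≠ 0 := by
    by_contra! h
    exact hL (ContinuousLinearMap.ext h)
  set v := (L w)⁻¹ • w with hv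
  have hLv : L v = 1 := by simp [hv, hw]
  set F : E → E := fun q => q + (g q - L q) • v with hF
  have hFs : ContDiff ℝ ∞ F := by fun_prop
  have hFd : fderiv ℝ F p = ContinuousLinearMap.id ℝ E := by
    have h1 : HasFDerivAt F (ContinuousLinearMap.id ℝ E + (L - L).smulRight v) p :=
      (hasFDerivAt_id p).add
        ((((hg.differentiable (by simp)) p).hasFDerivAt.sub L.hasFDerivAt).smul_const v)
    rw [h1.fderiv]
    simp
  have hFd' : HasFDerivAt F ((ContinuousLinearEquiv.refl ℝ E : E ≃L[ℝ] E) : E →L[ℝ] E) p := by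
    have := (hFs.differentiable (by simp) p).hasFDerivAt
    rwa [hFd] at this
  have hFat : ContDiffAt ℝ ∞ F p := hFs.contDiffAt
  set e₀ := hFat.toOpenPartialHomeomorph F hFd' (by simp) with he₀
  have he₀F : (e₀ : E → E) = F := rfl
  -- The chart is restricted to where its derivative is invertible, so that its inverse is smooth.
  set W : Set E := (fderiv ℝ F ⁻¹' range ((↑) : (E ≃L[ℝ] E) → E →L[ℝ] E)) ∩ U with hW
  have hWo : IsOpen W :=
    ((ContinuousLinearEquiv.isOpen).preimage (hFs.continuous_fderiv (by simp))).inter hU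
  have hpW : p ∈ W := ⟨⟨ContinuousLinearEquiv.refl ℝ E, hFd.symm⟩, hp⟩
  refine ⟨e₀.restrOpen W hWo, ⟨hFat.mem_toOpenPartialHomeomorph_source hFd' (by simp), hpW⟩,
    ⟨hFs.contDiffOn, ?_, ?_⟩, hFd⟩
  · intro z hz
    refine ContDiffAt.contDiffWithinAt ?_
    obtain ⟨A, hA⟩ := ((e₀.restrOpen W hWo).map_target hz).2.1
    refine (e₀.restrOpen W hWo).contDiffAt_symm hz (f₀' := A) ?_ hFs.contDiffAt
    rw [hA]
    exact (hFs.differentiable (by simp) _).hasFDerivAt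
  · intro q hq
    have hLF : L (F q) = g q := by simp [hF, hLv]
    have : (e₀.restrOpen W hWo) q = F q := rfl
    rw [this, LinearMap.mem_ker]
    change _ ↔ L (F q) = 0
    rw [hLF]
    exact ⟨fun h => h.2, fun h => ⟨hq.2.2, h⟩⟩

/-! ### The phase function -/

section PartialDerivatives

variable {E F G : Type*} [NormedAddCommGroup E] [NormedSpace ℝ E] [NormedAddCommGroup F]
  [NormedSpace ℝ F] [NormedAddCommGroup G] [NormedSpace ℝ G] {f : E × F → G}
  {f' : E × F →L[ℝ] G} {p : E × F}

lemma hasFDerivAt_partial_fst (h : HasFDerivAt f f' p) :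
    HasFDerivAt (fun x => f (x, p.2)) (f'.comp (ContinuousLinearMap.inl ℝ E F)) p.1 :=
  HasFDerivAt.comp (f := fun x => (x, p.2)) (g := f) p.1 h (hasFDerivAt_prodMk_left p.1 p.2)

lemma hasFDerivAt_partial_snd (h : HasFDerivAt f f' p) :
    HasFDerivAt (fun x => f (p.1, x)) (f'.comp (ContinuousLinearMap.inr ℝ E F)) p.2 :=
  HasFDerivAt.comp (f := fun x => (p.1, x)) (g := f) p.2 h (hasFDerivAt_prodMk_right p.1 p.2)

end PartialDerivatives

section Phase

variable {n : ℕ} {r : Eucl n → ℝ}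

/-- The defining function `|x - y|² - r(y)²` of the incidence relation `x ∈ S(y)`. -/
noncomputable def sphereDefect (r : Eucl n → ℝ) (q : Eucl n × Eucl n) : ℝ :=
  ‖q.2 - q.1‖ ^ 2 - r q.1 ^ 2

lemma contDiff_sphereDefect (hr : ContDiff ℝ ∞ r) : ContDiff ℝ ∞ (sphereDefect r) := by
  unfold sphereDefect
  have : ContDiff ℝ ∞ fun q : Eucl n × Eucl n => ‖q.2 - q.1‖ ^ 2 :=
    (contDiff_snd.sub contDiff_fst).norm_sq ℝ
  fun_prop

lemma sphericalPhase_eq (p : (Eucl n × Eucl n) × Eucl 1) :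
    sphericalPhase r p = p.2 0 * sphereDefect r p.1 := rfl

lemma contDiff_sphericalPhase (hr : ContDiff ℝ ∞ r) : ContDiff ℝ ∞ (sphericalPhase r) := by
  have h := (contDiff_sphereDefect hr).comp
    (contDiff_fst : ContDiff ℝ ∞ (Prod.fst : (Eucl n × Eucl n) × Eucl 1 → _))
  have h2 : ContDiff ℝ ∞ fun p : (Eucl n × Eucl n) × Eucl 1 => p.2 0 := by fun_prop
  exact h2.mul h

lemma dSigma_sphericalPhase (p : (Eucl n × Eucl n) × Eucl 1) :
    dSigma (sphericalPhase r) p = sphereDefect r p.1 • EuclideanSpace.single 0 1 := by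
  refine HasGradientAt.gradient ?_
  rw [hasGradientAt_iff_hasFDerivAt]
  have h : HasFDerivAt (fun σ : Eucl 1 => σ 0 * sphereDefect r p.1)
      (sphereDefect r p.1 • (EuclideanSpace.proj 0 : Eucl 1 →L[ℝ] ℝ)) p.2 :=
    (EuclideanSpace.proj (0 : Fin 1) : Eucl 1 →L[ℝ] ℝ).hasFDerivAt.mul_const _
  convert! h using 1
  ext v
  simp [EuclideanSpace.inner_single_left]

lemma hasGradientAt_norm_sub_sq {E : Type*} [NormedAddCommGroup E] [InnerProductSpace ℝ E]
    [CompleteSpace E] (y x : E) :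
    HasGradientAt (fun x => ‖x - y‖ ^ 2) ((2 : ℝ) • (x - y)) x := by
  rw [hasGradientAt_iff_hasFDerivAt]
  have h := ((hasFDerivAt_id x).sub_const y).norm_sq
  convert! h using 1
  ext v
  simp

lemma dX_sphericalPhase (p : (Eucl n × Eucl n) × Eucl 1) :
    dX (sphericalPhase r) p = (2 * p.2 0) • (p.1.2 - p.1.1) := by
  refine HasGradientAt.gradient ?_
  rw [hasGradientAt_iff_hasFDerivAt]
  have h := (((hasGradientAt_norm_sub_sq p.1.1 p.1.2).hasFDerivAt).sub_const
    (r p.1.1 ^ 2)).const_mul (p.2 0)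
  convert! h using 1
  ext v
  simp
  ring

lemma dY_sphericalPhase (hr : ContDiff ℝ ∞ r) (p : (Eucl n × Eucl n) × Eucl 1) :
    dY (sphericalPhase r) p =
      (-2 * p.2 0) • ((p.1.2 - p.1.1) + r p.1.1 • ∇ r p.1.1) := by
  refine HasGradientAt.gradient ?_
  rw [hasGradientAt_iff_hasFDerivAt]
  have h1 := (hasGradientAt_norm_sub_sq p.1.2 p.1.1).hasFDerivAt
  have h2 := ((hr.differentiable (by simp)) p.1.1).hasGradientAt.hasFDerivAt
  have h := (h1.sub (h2.pow 2)).const_mul (p.2 0)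
  have e : (fun y => sphericalPhase r ((y, p.1.2), p.2)) =
      fun y => p.2 0 * (‖y - p.1.2‖ ^ 2 - r y ^ 2) := by
    funext y
    simp only [sphericalPhase, norm_sub_rev p.1.2 y]
  rw [e]
  convert! h using 1
  ext v
  simp
  ring

lemma mem_criticalSet_sphericalPhase {p : (Eucl n × Eucl n) × Eucl 1} :
    p ∈ criticalSet ⊤ ⊤ (sphericalPhase r) ↔ p.2 0 ≠ 0 ∧ sphereDefect r p.1 = 0 := by
  have h : p.2 = 0 ↔ p.2 0 = 0 := by
    constructor
    · intro h; simp [h]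
    · intro h; ext i; fin_cases i; simpa using h
  simp [criticalSet, phaseDomain, dSigma_sphericalPhase, h]

lemma norm_sub_eq_of_sphereDefect_eq_zero (hpos : ∀ y, 0 < r y) {q : Eucl n × Eucl n}
    (h : sphereDefect r q = 0) : ‖q.2 - q.1‖ = r q.1 :=
  (sq_eq_sq₀ (norm_nonneg _) (hpos _).le).1 (sub_eq_zero.1 h)

lemma fderiv_sphereDefect_ne_zero (hr : ContDiff ℝ ∞ r) (hpos : ∀ y, 0 < r y)
    {q : Eucl n × Eucl n} (h : sphereDefect r q = 0) : fderiv ℝ (sphereDefect r) q ≠ 0 := by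
  intro h0
  have hn := norm_sub_eq_of_sphereDefect_eq_zero hpos h
  have h1 := hasFDerivAt_partial_snd
    (((contDiff_sphereDefect hr).differentiable (by simp)) q).hasFDerivAt
  have h2 := ((hasGradientAt_norm_sub_sq q.1 q.2).hasFDerivAt).sub_const (r q.1 ^ 2)
  have h3 := DFunLike.congr_fun (h1.unique h2) (q.2 - q.1)
  rw [h0] at h3
  simp only [ContinuousLinearMap.zero_comp, zero_apply,
    InnerProductSpace.toDual_apply_apply, inner_smul_left, real_inner_self_eq_norm_sq, hn] at h3
  simp [(hpos q.1).ne'] at h3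

lemma fderiv_sphericalPhase_ne_zero (hr : ContDiff ℝ ∞ r) (hpos : ∀ y, 0 < r y)
    {p : (Eucl n × Eucl n) × Eucl 1} (hp : p.2 0 ≠ 0) : fderiv ℝ (sphericalPhase r) p ≠ 0 := by
  intro h0
  have hd := (((contDiff_sphericalPhase hr).differentiable (by simp)) p).hasFDerivAt
  have hσ : sphereDefect r p.1 = 0 := by
    have h1 := hasFDerivAt_partial_snd hd
    have h2 : dSigma (sphericalPhase r) p = 0 := by
      rw [dSigma, gradient, h1.fderiv, h0]
      simp
    simpa [dSigma_sphericalPhase] using h2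
  have hx : dX (sphericalPhase r) p = 0 := by
    have h1 := hasFDerivAt_partial_snd (hasFDerivAt_partial_fst hd)
    rw [dX, gradient, h1.fderiv, h0]
    simp
  have hn := norm_sub_eq_of_sphereDefect_eq_zero hpos hσ
  have hr0 := (hpos p.1.1).ne'
  rw [dX_sphericalPhase] at hx
  rcases smul_eq_zero.1 hx with h | h
  · exact hp (by simpa using h)
  · rw [h, norm_zero] at hn
    exact hr0 hn.symm

lemma ker_fderiv_dSigma_sphericalPhase (hr : ContDiff ℝ ∞ r)
    (p : (Eucl n × Eucl n) × Eucl 1) :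
    (fderiv ℝ (dSigma (sphericalPhase r)) p).ker =
      (fderiv ℝ (fun p : (Eucl n × Eucl n) × Eucl 1 => sphereDefect r p.1) p).ker := by
  have hd : DifferentiableAt ℝ (fun p : (Eucl n × Eucl n) × Eucl 1 => sphereDefect r p.1) p :=
    ((contDiff_sphereDefect hr).comp contDiff_fst).differentiable (by simp) p
  have h : dSigma (sphericalPhase r) = fun p : (Eucl n × Eucl n) × Eucl 1 =>
      sphereDefect r p.1 • (EuclideanSpace.single 0 1 : Eucl 1) :=
    funext dSigma_sphericalPhase
  rw [h, (hd.hasFDerivAt.smul_const _).fderiv]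
  ext v
  simp

theorem isCleanPhase_sphericalPhase (hr : ContDiff ℝ ∞ r) (hpos : ∀ y, 0 < r y) :
    IsCleanPhase ⊤ ⊤ (sphericalPhase r) := by
  set g : (Eucl n × Eucl n) × Eucl 1 → ℝ := fun p => sphereDefect r p.1 with hg
  have hgs : ContDiff ℝ ∞ g := (contDiff_sphereDefect hr).comp contDiff_fst
  set U : Set ((Eucl n × Eucl n) × Eucl 1) := {p | p.2 0 ≠ 0} with hU
  have hUo : IsOpen U := isOpen_ne_fun (by fun_prop) continuous_const
  have hcrit : criticalSet ⊤ ⊤ (sphericalPhase r) = {p ∈ U | g p = 0} := by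
    ext p
    exact mem_criticalSet_sphericalPhase
  have hne : ∀ p, g p = 0 → fderiv ℝ g p ≠ 0 := by
    intro p hp h0
    refine fderiv_sphereDefect_ne_zero hr hpos hp ?_
    have h1 : HasFDerivAt (sphereDefect r) _ p.1 :=
      hasFDerivAt_partial_fst (hgs.differentiable (by simp) p).hasFDerivAt
    rw [h1.fderiv, h0]
    simp
  refine ⟨⟨(contDiff_sphericalPhase hr).contDiffOn, ?_, ?_⟩, ?_, ?_⟩
  · intro p _ t _
    simp only [sphericalPhase, PiLp.smul_apply, smul_eq_mul]
    ring
  · intro p hp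
    refine fderiv_sphericalPhase_ne_zero hr hpos fun h => hp.2 ?_
    ext i
    fin_cases i
    simpa using h
  · rw [hcrit]
    intro p hp
    obtain ⟨e, h1, h2, -⟩ := exists_sliceChart_levelSet hgs hUo hp.1 (hne p hp.2)
    exact ⟨e, _, h1, h2⟩
  · rw [hcrit]
    intro p hp
    obtain ⟨e, h1, h2, h3⟩ := exists_sliceChart_levelSet hgs hUo hp.1 (hne p hp.2)
    refine ⟨e, _, h1, h2, ?_⟩
    rw [h3, ker_fderiv_dSigma_sphericalPhase hr]
    rfl

/-- The hypothesis `|∇r| ≠ 1` keeps `d_y Φ = -2σ (x - y + r ∇r)` away from zero on the critical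
set, where `|x - y| = r`. -/
theorem isNondegenerate_sphericalPhase (hr : ContDiff ℝ ∞ r) (hpos : ∀ y, 0 < r y)
    (hgrad : ∀ y, ‖∇ r y‖ ≠ 1) : IsNondegenerate ⊤ ⊤ (sphericalPhase r) := by
  intro p hp
  obtain ⟨hσ, hd⟩ := mem_criticalSet_sphericalPhase.1 hp
  have hn := norm_sub_eq_of_sphereDefect_eq_zero hpos hd
  have hr0 := hpos p.1.1
  constructor
  · rw [dY_sphericalPhase hr]
    refine smul_ne_zero (by simpa using hσ) fun h => hgrad p.1.1 ?_
    rw [eq_neg_of_add_eq_zero_left h, norm_neg, norm_smul, Real.norm_of_nonneg hr0.le] at hn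
    exact mul_left_cancel₀ hr0.ne' (hn.trans (mul_one _).symm)
  · rw [dX_sphericalPhase]
    refine smul_ne_zero (by simpa using hσ) fun h => ?_
    rw [h, norm_zero] at hn
    exact hr0.ne hn

end Phase

/-! ### The canonical relation -/

lemma _root_.HasMFDerivAt.prodMap_space {E F E' F' H H' M N : Type*}
    [NormedAddCommGroup E] [NormedSpace ℝ E] [NormedAddCommGroup F] [NormedSpace ℝ F]
    [NormedAddCommGroup E'] [NormedSpace ℝ E'] [NormedAddCommGroup F'] [NormedSpace ℝ F']
    [TopologicalSpace H] [TopologicalSpace H'] [TopologicalSpace M] [TopologicalSpace N]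
    [ChartedSpace H M] [ChartedSpace H' N] {I : ModelWithCorners ℝ E' H}
    {J : ModelWithCorners ℝ F' H'} {f : M → E} {g : N → F} {p : M × N} {f' : E' →L[ℝ] E}
    {g' : F' →L[ℝ] F} (hf : HasMFDerivAt I 𝓘(ℝ, E) f p.1 f')
    (hg : HasMFDerivAt J 𝓘(ℝ, F) g p.2 g') :
    HasMFDerivAt (I.prod J) 𝓘(ℝ, E × F) (Prod.map f g) p (f'.prodMap g') := by
  rw [modelWithCornersSelf_prod, ← chartedSpaceSelf_prod]
  have h := hf.prodMap hg
  rw [hf.mfderiv, hg.mfderiv] at h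
  exact h

section Parametrization

variable {n : ℕ} {r : Eucl n → ℝ}

/-- A left inverse of `sphericalCoordinates`, defined and smooth on all of `ℝ⁴ⁿ`, with values in
the ambient space `ℝⁿ × ℝⁿ × ℝ` of the parameters: it recovers `θ = (x - y) / r(y)` and
`σ = -⟨ξ, x - y⟩ / (2 r(y)²)`. -/
noncomputable def sphericalCoordinatesInv (r : Eucl n → ℝ)
    (z : (Eucl n × Eucl n) × (Eucl n × Eucl n)) : Eucl n × Eucl n × ℝ :=
  (z.1.1, (r z.1.1)⁻¹ • (z.2.1 - z.1.1),
    -(2 * r z.1.1 ^ 2)⁻¹ * inner ℝ z.2.2 (z.2.1 - z.1.1))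

/-- The inclusion of the parameter manifold `ℝⁿ × Sⁿ⁻¹ × (ℝ ∖ 0)` into `ℝⁿ × ℝⁿ × ℝ`. -/
def parameterInclusion (q : Eucl n × Metric.sphere (0 : Eucl n) 1 × puncturedLine) :
    Eucl n × Eucl n × ℝ :=
  (q.1, (q.2.1 : Eucl n), (q.2.2 : ℝ))

lemma sphericalCoordinatesInv_comp (hpos : ∀ y, 0 < r y) :
    sphericalCoordinatesInv r ∘ sphericalCoordinates r = parameterInclusion := by
  funext ⟨y, θ, σ⟩
  have hr0 := (hpos y).ne'
  have hθ : ‖(θ : Eucl n)‖ = 1 := by simp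
  simp only [Function.comp, sphericalCoordinatesInv, sphericalCoordinates, parameterInclusion,
    add_sub_cancel_left, smul_smul, inner_smul_left, inner_smul_right, real_inner_self_eq_norm_sq,
    hθ, inv_mul_cancel₀ hr0, one_smul, Prod.mk.injEq, true_and]
  simp
  field_simp

lemma contDiff_sphericalCoordinatesInv (hr : ContDiff ℝ ∞ r) (hpos : ∀ y, 0 < r y) :
    ContDiff ℝ ∞ (sphericalCoordinatesInv r) := by
  have h1 : ContDiff ℝ ∞ fun z : (Eucl n × Eucl n) × (Eucl n × Eucl n) => r z.1.1 := by fun_prop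
  have h2 : ContDiff ℝ ∞ fun z : (Eucl n × Eucl n) × (Eucl n × Eucl n) => z.2.1 - z.1.1 := by
    fun_prop
  have h3 : ContDiff ℝ ∞ fun z : (Eucl n × Eucl n) × (Eucl n × Eucl n) => (r z.1.1)⁻¹ :=
    h1.inv fun z => (hpos _).ne'
  have h4 : ContDiff ℝ ∞ fun z : (Eucl n × Eucl n) × (Eucl n × Eucl n) => (2 * r z.1.1 ^ 2)⁻¹ :=
    (contDiff_const.mul (h1.pow 2)).inv fun z => by have := hpos z.1.1; positivity
  exact (contDiff_fst.fst).prodMk ((h3.smul h2).prodMk (h4.neg.mul (contDiff_snd.snd.inner ℝ h2)))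

lemma contDiff_gradient (hr : ContDiff ℝ ∞ r) : ContDiff ℝ ∞ (∇ r) :=
  (InnerProductSpace.toDual ℝ (Eucl n)).symm.toContinuousLinearEquiv.contDiff.comp
    (hr.fderiv_right (m := ∞) (by simp))

/-- The formula for `sphericalCoordinates r`, on the ambient space of the parameters. -/
lemma exists_contDiff_extension_sphericalCoordinates (hr : ContDiff ℝ ∞ r) :
    ∃ G : Eucl n × Eucl n × ℝ → (Eucl n × Eucl n) × (Eucl n × Eucl n),
      ContDiff ℝ ∞ G ∧ sphericalCoordinates r = G ∘ parameterInclusion := by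
  refine ⟨fun q => ((q.1, (-2 * q.2.2 * r q.1) • (q.2.1 + ∇ r q.1)),
    (q.1 + r q.1 • q.2.1, (-2 * q.2.2 * r q.1) • q.2.1)), ?_, rfl⟩
  have := contDiff_gradient hr
  fun_prop

lemma isEmbedding_parameterInclusion : IsEmbedding (parameterInclusion (n := n)) :=
  IsEmbedding.id.prodMap (IsEmbedding.subtypeVal.prodMap IsEmbedding.subtypeVal)

variable [NeZero n]

lemma contMDiff_parameterInclusion :
    ContMDiff (𝓘(ℝ, Eucl n).prod ((𝓡 (n - 1)).prod 𝓘(ℝ, ℝ))) 𝓘(ℝ, Eucl n × Eucl n × ℝ) ∞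
      (parameterInclusion (n := n)) := by
  refine ContMDiff.prodMk_space contMDiff_fst (ContMDiff.prodMk_space ?_ ?_)
  · exact contMDiff_coe_sphere.comp (contMDiff_fst.comp contMDiff_snd)
  · exact (contMDiff_subtype_val (U := puncturedLine)).comp (contMDiff_snd.comp contMDiff_snd)

lemma hasMFDerivAt_puncturedLine_val (σ : puncturedLine) :
    HasMFDerivAt 𝓘(ℝ, ℝ) 𝓘(ℝ, ℝ) (Subtype.val : puncturedLine → ℝ) σ
      (ContinuousLinearMap.id ℝ ℝ) := by
  refine ⟨continuous_subtype_val.continuousAt, HasFDerivAt.hasFDerivWithinAt ?_⟩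
  refine (hasFDerivAt_id (𝕜 := ℝ) (extChartAt 𝓘(ℝ, ℝ) σ σ)).congr_of_eventuallyEq ?_
  filter_upwards [extChartAt_target_mem_nhds (I := 𝓘(ℝ, ℝ)) σ] with t ht
  exact (extChartAt 𝓘(ℝ, ℝ) σ).right_inv ht

lemma exists_hasMFDerivAt_sphere_val (θ : Metric.sphere (0 : Eucl n) 1) :
    ∃ D : Eucl (n - 1) →L[ℝ] Eucl n, HasMFDerivAt (𝓡 (n - 1)) 𝓘(ℝ, Eucl n)
      ((↑) : Metric.sphere (0 : Eucl n) 1 → Eucl n) θ D ∧ Function.Injective D :=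
  ⟨_, ((contMDiff_coe_sphere (m := 1)).mdifferentiableAt (by simp)).hasMFDerivAt,
    injective_mvfderiv_subtypeVal_sphere (n := n - 1) θ⟩

lemma mfderiv_parameterInclusion_injective
    (q : Eucl n × Metric.sphere (0 : Eucl n) 1 × puncturedLine) :
    Function.Injective (mfderiv (𝓘(ℝ, Eucl n).prod ((𝓡 (n - 1)).prod 𝓘(ℝ, ℝ)))
      𝓘(ℝ, Eucl n × Eucl n × ℝ) parameterInclusion q) := by
  obtain ⟨D, hD, hinj⟩ := exists_hasMFDerivAt_sphere_val q.2.1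
  have hid : HasMFDerivAt 𝓘(ℝ, Eucl n) 𝓘(ℝ, Eucl n) id q.1
    (ContinuousLinearMap.id ℝ (Eucl n)) := hasMFDerivAt_id q.1
  have hm : HasMFDerivAt (𝓘(ℝ, Eucl n).prod ((𝓡 (n - 1)).prod 𝓘(ℝ, ℝ)))
      𝓘(ℝ, Eucl n × Eucl n × ℝ) parameterInclusion q
      ((ContinuousLinearMap.id ℝ (Eucl n)).prodMap
        (D.prodMap (ContinuousLinearMap.id ℝ ℝ))) :=
    hid.prodMap_space (hD.prodMap_space (hasMFDerivAt_puncturedLine_val q.2.2))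
  rw [hm.mfderiv]
  exact Function.injective_id.prodMap (hinj.prodMap Function.injective_id)

theorem isGlobalParametrization_sphericalCoordinates (hr : ContDiff ℝ ∞ r)
    (hpos : ∀ y, 0 < r y) :
    IsGlobalParametrization (𝓘(ℝ, Eucl n).prod ((𝓡 (n - 1)).prod 𝓘(ℝ, ℝ)))
      (sphericalCoordinates r) (canonicalRelation ⊤ ⊤ (sphericalPhase r)) := by
  obtain ⟨G, hG, hκ⟩ := exists_contDiff_extension_sphericalCoordinates hr
  have hinv := sphericalCoordinatesInv_comp hpos
  have hI := contDiff_sphericalCoordinatesInv hr hpos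
  have hsm : ContMDiff (𝓘(ℝ, Eucl n).prod ((𝓡 (n - 1)).prod 𝓘(ℝ, ℝ)))
      𝓘(ℝ, (Eucl n × Eucl n) × (Eucl n × Eucl n)) ∞ (sphericalCoordinates r) :=
    hκ ▸ hG.contMDiff.comp contMDiff_parameterInclusion
  refine ⟨hsm, fun q => ?_, ?_, ?_⟩
  · have h := mfderiv_parameterInclusion_injective q
    rw [← hinv, mfderiv_comp q (hI.contMDiff.mdifferentiableAt (by simp))
      (hsm.mdifferentiableAt (by simp))] at h
    exact Function.Injective.of_comp h
  · exact .of_comp hsm.continuous hI.continuous (hinv ▸ isEmbedding_parameterInclusion)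
  · ext z
    constructor
    · rintro ⟨⟨y, θ, σ⟩, rfl⟩
      have hθ : ‖(θ : Eucl n)‖ = 1 := by simp
      refine ⟨((y, y + r y • (θ : Eucl n)), EuclideanSpace.single 0 (σ : ℝ)),
        mem_criticalSet_sphericalPhase.2 ⟨by simpa using (show (σ : ℝ) ≠ 0 from σ.2), ?_⟩, ?_⟩
      · simp [sphereDefect, norm_smul, hθ]
      · simp only [dY_sphericalPhase hr, dX_sphericalPhase, sphericalCoordinates,
          add_sub_cancel_left, ← smul_add, smul_smul, ← neg_smul]
        simp
    · rintro ⟨⟨⟨y, x⟩, s⟩, hp, rfl⟩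
      obtain ⟨hs, hd⟩ := mem_criticalSet_sphericalPhase.1 hp
      have hn := norm_sub_eq_of_sphereDefect_eq_zero hpos hd
      have hr0 := hpos y
      simp only at hn hs
      refine ⟨(y, ⟨(r y)⁻¹ • (x - y), ?_⟩, ⟨s 0, hs⟩), ?_⟩
      · rw [mem_sphere_zero_iff_norm, norm_smul, hn, norm_inv, Real.norm_of_nonneg hr0.le,
          inv_mul_cancel₀ hr0.ne']
      · simp only [dY_sphericalPhase hr, dX_sphericalPhase, sphericalCoordinates, smul_add,
          smul_smul, ← neg_smul, mul_inv_cancel₀ hr0.ne', one_smul, add_sub_cancel]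
        rw [mul_assoc _ (r y) (r y)⁻¹, mul_inv_cancel₀ hr0.ne', mul_one, neg_mul]

end Parametrization

/-! ### Polar coordinates around a moving centre -/

section Polar

variable {E : Type*} [NormedAddCommGroup E] [NormedSpace ℝ E] [MeasurableSpace E] [BorelSpace E]
  [FiniteDimensional ℝ E] [Nontrivial E] (μ : Measure E) [μ.IsAddHaarMeasure]

lemma measurePreserving_polar :
    MeasurePreserving (fun p : Metric.sphere (0 : E) 1 × Ioi (0 : ℝ) => (p.2 : ℝ) • (p.1 : E))
      (μ.toSphere.prod (Measure.volumeIoiPow (Module.finrank ℝ E - 1))) μ := by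
  have h1 := μ.measurePreserving_homeomorphUnitSphereProd.symm
    (homeomorphUnitSphereProd E).toMeasurableEquiv
  have h2 := measurePreserving_subtype_coe (μa := μ) (measurableSet_singleton (0 : E)).compl
  rw [restrict_compl_singleton] at h2
  exact h2.comp h1

lemma measurePreserving_movingPolar :
    MeasurePreserving (fun p : (E × Metric.sphere (0 : E) 1) × Ioi (0 : ℝ) =>
        (p.1.1, p.1.1 + (p.2 : ℝ) • (p.1.2 : E)))
      ((μ.prod μ.toSphere).prod (Measure.volumeIoiPow (Module.finrank ℝ E - 1)))
      (μ.prod μ) :=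
  (measurePreserving_prod_add μ μ).comp
    (((MeasurePreserving.id μ).prod (measurePreserving_polar μ)).comp
      (measurePreserving_prodAssoc _ _ _))

lemma integral_volumeIoiPow (k : ℕ) (f : ℝ → ℂ) :
    ∫ s : Ioi (0 : ℝ), f s ∂Measure.volumeIoiPow k = ∫ s in Ioi (0 : ℝ), s ^ k • f s := by
  rw [Measure.volumeIoiPow, integral_withDensity_eq_integral_toReal_smul (by fun_prop) (by simp),
    integral_subtype_comap measurableSet_Ioi fun a : ℝ => (ENNReal.ofReal (a ^ k)).toReal • f a]
  refine setIntegral_congr_fun measurableSet_Ioi fun s hs => ?_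
  rw [ENNReal.toReal_ofReal (pow_nonneg (le_of_lt hs) _)]

lemma integrable_radialIntegral {F : E × E → ℂ} (hF : Integrable F (μ.prod μ)) :
    Integrable (fun w : E × Metric.sphere (0 : E) 1 =>
      ∫ s in Ioi (0 : ℝ), s ^ (Module.finrank ℝ E - 1) • F (w.1, w.1 + s • (w.2 : E)))
      (μ.prod μ.toSphere) := by
  have h := ((measurePreserving_movingPolar μ).integrable_comp_of_integrable hF).integral_prod_left
  refine h.congr (Eventually.of_forall fun w => ?_)
  exact integral_volumeIoiPow _ fun s => F (w.1, w.1 + s • (w.2 : E))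

lemma integral_prod_eq_integral_radialIntegral {F : E × E → ℂ} (hF : Integrable F (μ.prod μ)) :
    ∫ q, F q ∂μ.prod μ = ∫ w : E × Metric.sphere (0 : E) 1,
      (∫ s in Ioi (0 : ℝ), s ^ (Module.finrank ℝ E - 1) • F (w.1, w.1 + s • (w.2 : E)))
      ∂μ.prod μ.toSphere := by
  have hm := measurePreserving_movingPolar μ
  rw [← hm.map_eq, integral_map hm.measurable.aemeasurable
    (by rw [hm.map_eq]; exact hF.aestronglyMeasurable)]
  refine (integral_prod _ (hm.integrable_comp_of_integrable hF)).trans ?_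
  refine integral_congr_ae (Eventually.of_forall fun w => ?_)
  exact integral_volumeIoiPow _ fun s => F (w.1, w.1 + s • (w.2 : E))

end Polar

/-! ### The radial approximate identity -/

section ApproximateIdentity

variable {φ : ℝ → ℂ} {C M ρ ε : ℝ} {H : ℝ → ℂ}

/-- The kernel `ε⁻¹ φ(-(s² - ρ²) / (2πε))` becomes `φ(-v (2ρ + εv) / 2π)` under `s = ρ + ε v`. -/
lemma integral_radial_substitution (hε : 0 < ε) :
    ∫ s in Ioi (0 : ℝ), H s * ((ε⁻¹ : ℝ) * φ (-(s ^ 2 - ρ ^ 2) / (2 * Real.pi * ε))) =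
      ∫ v, (if 0 < ρ + ε * v then
        H (ρ + ε * v) * φ (-(v * (2 * ρ + ε * v)) / (2 * Real.pi)) else 0) := by
  rw [← integral_indicator measurableSet_Ioi]
  set G : ℝ → ℂ := (Ioi (0 : ℝ)).indicator
    fun s => H s * ((ε⁻¹ : ℝ) * φ (-(s ^ 2 - ρ ^ 2) / (2 * Real.pi * ε))) with hG
  have h1 : ∫ v, G (ρ + ε * v) = |ε⁻¹| • ∫ s, G s := by
    rw [Measure.integral_comp_mul_left (fun s => G (ρ + s)) ε, integral_add_left_eq_self G ρ]
  have h2 : ∫ s, G s = ∫ v, (ε : ℂ) * G (ρ + ε * v) := by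
    rw [integral_const_mul, h1, abs_of_pos (inv_pos.2 hε), Complex.real_smul, ← mul_assoc,
      ← Complex.ofReal_mul, mul_inv_cancel₀ hε.ne', Complex.ofReal_one, one_mul]
  rw [h2]
  refine integral_congr_ae (Eventually.of_forall fun v => ?_)
  simp only [hG, indicator, mem_Ioi]
  split_ifs with h
  · have e : -((ρ + ε * v) ^ 2 - ρ ^ 2) / (2 * Real.pi * ε) =
        -(v * (2 * ρ + ε * v)) / (2 * Real.pi) := by
      field_simp
      ring
    rw [e]
    have : (ε : ℂ) ≠ 0 := by exact_mod_cast hε.ne'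
    push_cast
    field_simp
  · simp

/-- For `s = ρ + ε v > 0` one has `|s² - ρ²| = ε |v| (s + ρ) ≥ ε ρ |v|`, which gives a bound
independent of `ε`. -/
lemma norm_radial_integrand_le (hφ : ∀ x, ‖φ x‖ ≤ C * (1 + x ^ 2)⁻¹) (hρ : 0 < ρ)
    (hH : ∀ s, 0 < s → ‖H s‖ ≤ M) (v : ℝ) :
    ‖(if 0 < ρ + ε * v then
        H (ρ + ε * v) * φ (-(v * (2 * ρ + ε * v)) / (2 * Real.pi)) else 0)‖ ≤
      M * (C * (1 + (ρ / (2 * Real.pi) * v) ^ 2)⁻¹) := by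
  have hM : 0 ≤ M := (norm_nonneg _).trans (hH 1 one_pos)
  have hC : 0 ≤ C := by simpa using (norm_nonneg _).trans (hφ 0)
  split_ifs with h
  · rw [norm_mul]
    refine mul_le_mul (hH _ h) ((hφ _).trans ?_) (norm_nonneg _) hM
    refine mul_le_mul_of_nonneg_left (inv_anti₀ (by positivity) ?_) hC
    refine add_le_add_right (sq_le_sq.2 ?_) 1
    rw [abs_div, abs_neg, abs_mul, abs_mul, abs_div, abs_of_pos hρ,
      abs_of_pos (by linarith : 0 < 2 * ρ + ε * v), div_mul_eq_mul_div, mul_comm ρ]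
    gcongr
    linarith
  · rw [norm_zero]
    positivity

lemma integrable_radial_majorant (hρ : 0 < ρ) :
    Integrable fun v : ℝ => M * (C * (1 + (ρ / (2 * Real.pi) * v) ^ 2)⁻¹) :=
  ((integrable_inv_one_add_sq.comp_mul_left' (by positivity)).const_mul C).const_mul M

lemma norm_radialIntegral_le (hφ : ∀ x, ‖φ x‖ ≤ C * (1 + x ^ 2)⁻¹) (hρ : 0 < ρ) (hε : 0 < ε)
    (hH : ∀ s, 0 < s → ‖H s‖ ≤ M) :
    ‖∫ s in Ioi (0 : ℝ), H s * ((ε⁻¹ : ℝ) * φ (-(s ^ 2 - ρ ^ 2) / (2 * Real.pi * ε)))‖ ≤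
      2 * Real.pi ^ 2 * M * C / ρ := by
  rw [integral_radial_substitution hε]
  refine (norm_integral_le_of_norm_le (integrable_radial_majorant hρ)
    (Eventually.of_forall (norm_radial_integrand_le hφ hρ hH))).trans_eq ?_
  rw [integral_const_mul, integral_const_mul,
    Measure.integral_comp_mul_left (fun x : ℝ => (1 + x ^ 2)⁻¹), integral_univ_inv_one_add_sq,
    abs_of_pos (by positivity), smul_eq_mul]
  field_simp

lemma tendsto_radialIntegral (hφc : Continuous φ) (hφ : ∀ x, ‖φ x‖ ≤ C * (1 + x ^ 2)⁻¹)
    (hφ1 : ∫ x, φ x = 1) (hρ : 0 < ρ) (hHc : Continuous H) (hH : ∀ s, 0 < s → ‖H s‖ ≤ M) :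
    Tendsto (fun ε : ℝ => ∫ s in Ioi (0 : ℝ),
        H s * ((ε⁻¹ : ℝ) * φ (-(s ^ 2 - ρ ^ 2) / (2 * Real.pi * ε))))
      (𝓝[>] 0) (𝓝 (H ρ * ((Real.pi / ρ : ℝ) : ℂ))) := by
  have hlim : ∫ v, H ρ * φ (-(ρ / Real.pi) * v) = H ρ * ((Real.pi / ρ : ℝ) : ℂ) := by
    rw [integral_const_mul, Measure.integral_comp_mul_left φ, hφ1, inv_neg, abs_neg,
      abs_of_pos (by positivity), inv_div, Complex.real_smul, mul_one]
  rw [← hlim]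
  refine Tendsto.congr' (f₁ := fun ε : ℝ => ∫ v, (if 0 < ρ + ε * v then
    H (ρ + ε * v) * φ (-(v * (2 * ρ + ε * v)) / (2 * Real.pi)) else 0)) ?_ ?_
  · filter_upwards [self_mem_nhdsWithin] with ε hε
    exact (integral_radial_substitution hε).symm
  · refine tendsto_integral_filter_of_dominated_convergence
      (fun v : ℝ => M * (C * (1 + (ρ / (2 * Real.pi) * v) ^ 2)⁻¹)) ?_
      (Eventually.of_forall fun ε => Eventually.of_forall (norm_radial_integrand_le hφ hρ hH))
      (integrable_radial_majorant hρ) (Eventually.of_forall fun v => ?_)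
    · refine Eventually.of_forall fun ε => Measurable.aestronglyMeasurable ?_
      refine Measurable.ite (measurableSet_lt measurable_const (by fun_prop)) ?_ measurable_const
      exact Continuous.measurable (by fun_prop)
    · have h1 : Tendsto (fun ε : ℝ => ρ + ε * v) (𝓝[>] 0) (𝓝 ρ) := by
        have : Continuous fun ε : ℝ => ρ + ε * v := by fun_prop
        simpa using (this.tendsto 0).mono_left nhdsWithin_le_nhds
      have h2 : Tendsto (fun ε : ℝ => H (ρ + ε * v) * φ (-(v * (2 * ρ + ε * v)) / (2 * Real.pi)))
          (𝓝[>] 0) (𝓝 (H ρ * φ (-(ρ / Real.pi) * v))) := by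
        have hc : Continuous fun ε : ℝ =>
            H (ρ + ε * v) * φ (-(v * (2 * ρ + ε * v)) / (2 * Real.pi)) := by fun_prop
        have h3 := (hc.tendsto 0).mono_left (nhdsWithin_le_nhds (s := Ioi (0 : ℝ)))
        have e : -(v * (2 * ρ + 0 * v)) / (2 * Real.pi) = -(ρ / Real.pi) * v := by
          field_simp
          ring
        rwa [e, zero_mul, add_zero] at h3
      refine h2.congr' ?_
      filter_upwards [h1.eventually_const_lt hρ] with ε hε
      rw [if_pos hε]

end ApproximateIdentity

/-! ### Fourier transform of the cut-off -/

section Cutoff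

variable {χ : Eucl 1 → ℝ}

/-- The isometry of `ℝ` with `ℝ¹`. -/
noncomputable def realIsoEuclOne : ℝ ≃ₗᵢ[ℝ] Eucl 1 :=
  (OrthonormalBasis.singleton (Fin 1) ℝ).repr

lemma realIsoEuclOne_apply (s : ℝ) (i : Fin 1) : realIsoEuclOne s i = s := by
  exact ((OrthonormalBasis.singleton (Fin 1) ℝ).repr_apply_apply s i).trans (by simp)

/-- The cut-off `χ` as a complex Schwartz function on `ℝ`. -/
noncomputable def cutoffSchwartz (hχ : ContDiff ℝ ∞ χ) (hc : HasCompactSupport χ) :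
    SchwartzMap ℝ ℂ :=
  HasCompactSupport.toSchwartzMap (f := fun s : ℝ => (χ (realIsoEuclOne s) : ℂ))
    ((hc.comp_homeomorph realIsoEuclOne.toHomeomorph).comp_left
      (g := ((↑) : ℝ → ℂ)) Complex.ofReal_zero)
    (Complex.ofRealCLM.contDiff.comp
      (hχ.comp realIsoEuclOne.toContinuousLinearEquiv.contDiff))

open FourierTransform in
lemma integral_cutoff_exp (hχ : ContDiff ℝ ∞ χ) (hc : HasCompactSupport χ) {ε : ℝ} (hε : 0 < ε)
    (t : ℝ) :
    ∫ σ : Eucl 1, Complex.exp (Complex.I * ((σ 0 * t : ℝ) : ℂ)) * (χ (ε • σ) : ℂ) =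
      (ε⁻¹ : ℝ) * 𝓕 (cutoffSchwartz hχ hc) (-t / (2 * Real.pi * ε)) := by
  rw [← realIsoEuclOne.measurePreserving.integral_comp
    realIsoEuclOne.toHomeomorph.measurableEmbedding]
  rw [SchwartzMap.fourier_coe, Real.fourier_real_eq_integral_exp_smul]
  have h := Measure.integral_comp_mul_left (fun s : ℝ =>
    Complex.exp (((-2 * Real.pi * s * (-t / (2 * Real.pi * ε)) : ℝ) : ℂ) * Complex.I) •
      (cutoffSchwartz hχ hc) s) ε
  rw [abs_of_pos (inv_pos.2 hε), Complex.real_smul] at h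
  rw [← h]
  refine integral_congr_ae (Eventually.of_forall fun s => ?_)
  have e : -2 * Real.pi * (ε * s) * (-t / (2 * Real.pi * ε)) = s * t := by field_simp
  simp only [realIsoEuclOne_apply, e, smul_eq_mul, mul_comm Complex.I]
  congr 2
  rw [← smul_eq_mul (a := ε), ← map_smul]

open FourierTransform in
lemma integral_fourier_cutoff (hχ : ContDiff ℝ ∞ χ) (hc : HasCompactSupport χ) :
    ∫ x, 𝓕 (cutoffSchwartz hχ hc) x = (χ 0 : ℂ) := by
  have h : 𝓕⁻ (𝓕 (cutoffSchwartz hχ hc)) = cutoffSchwartz hχ hc :=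
    FourierTransform.fourierInv_fourier_eq _
  have h0 := DFunLike.congr_fun h 0
  rw [SchwartzMap.fourierInv_coe, Real.fourierInv_eq'] at h0
  have e : cutoffSchwartz hχ hc 0 = (χ (realIsoEuclOne 0) : ℂ) := rfl
  rw [e, map_zero] at h0
  simpa using h0

lemma exists_schwartzMap_norm_le_inv_one_add_sq (f : SchwartzMap ℝ ℂ) :
    ∃ C, ∀ x, ‖f x‖ ≤ C * (1 + x ^ 2)⁻¹ := by
  obtain ⟨C₀, -, h0⟩ := f.decay 0 0
  obtain ⟨C₂, -, h2⟩ := f.decay 2 0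
  refine ⟨C₀ + C₂, fun x => ?_⟩
  have h0 := h0 x
  have h2 := h2 x
  simp only [norm_iteratedFDeriv_zero, Real.norm_eq_abs, sq_abs, pow_zero, one_mul] at h0 h2
  rw [← div_eq_mul_inv, le_div_iff₀ (by positivity)]
  linarith

end Cutoff

/-! ### The spherical transform and its Schwartz kernel -/

section Operator

variable {n : ℕ} {r : Eucl n → ℝ}

/-- The measure `dy dθ` on `ℝⁿ × Sⁿ⁻¹`. -/
noncomputable def centreDirectionMeasure (n : ℕ) :
    Measure (Eucl n × Metric.sphere (0 : Eucl n) 1) :=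
  (volume : Measure (Eucl n)).prod (volume : Measure (Eucl n)).toSphere

/-- The map `(y, θ) ↦ (y, y + r(y) θ)` parametrizing the incidence relation `x ∈ S(y)`. -/
def incidenceMap (r : Eucl n → ℝ) (w : Eucl n × Metric.sphere (0 : Eucl n) 1) :
    Eucl n × Eucl n :=
  (w.1, w.1 + r w.1 • (w.2 : Eucl n))

lemma continuous_incidenceMap (hr : Continuous r) : Continuous (incidenceMap r) := by
  unfold incidenceMap
  fun_prop

lemma sphericalTransform_eq_integral (hpos : ∀ y, 0 < r y) {f : Eucl n → ℂ} (hf : Continuous f)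
    (y : Eucl n) :
    sphericalTransform r f y = ∫ θ : Metric.sphere (0 : Eucl n) 1,
      ((r y ^ (n - 1) : ℝ) : ℂ) * f (incidenceMap r (y, θ)).2
        ∂(volume : Measure (Eucl n)).toSphere := by
  rw [sphericalTransform, sphereSurfaceMeasure, integral_smul_measure,
    ENNReal.toReal_ofReal (pow_nonneg (hpos y).le _),
    integral_map (Continuous.aemeasurable (by fun_prop)) hf.aestronglyMeasurable,
    integral_const_mul, Complex.real_smul]
  rfl

lemma continuous_sphericalTransform (hr : Continuous r) (hpos : ∀ y, 0 < r y)
    {f : Eucl n → ℂ} (hf : Continuous f) : Continuous (sphericalTransform r f) := by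
  have h : sphericalTransform r f = fun y => ∫ θ : Metric.sphere (0 : Eucl n) 1,
      ((r y ^ (n - 1) : ℝ) : ℂ) * f (incidenceMap r (y, θ)).2
        ∂(volume : Measure (Eucl n)).toSphere :=
    funext fun y => sphericalTransform_eq_integral hpos hf y
  rw [h]
  have hc : Continuous fun w : Eucl n × Metric.sphere (0 : Eucl n) 1 =>
      ((r w.1 ^ (n - 1) : ℝ) : ℂ) * f (incidenceMap r w).2 := by
    have := continuous_incidenceMap hr
    fun_prop
  have := continuous_parametric_integral_of_continuous
    (μ := (volume : Measure (Eucl n)).toSphere)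
    (f := fun (y : Eucl n) (θ : Metric.sphere (0 : Eucl n) 1) =>
      ((r y ^ (n - 1) : ℝ) : ℂ) * f (incidenceMap r (y, θ)).2) hc isCompact_univ
  simpa using this

lemma integrable_sphere_of_continuous {f : Metric.sphere (0 : Eucl n) 1 → ℂ}
    (hf : Continuous f) : Integrable f (volume : Measure (Eucl n)).toSphere :=
  hf.integrable_of_hasCompactSupport (HasCompactSupport.of_compactSpace f)

lemma integrable_sphericalTransform_integrand (hr : Continuous r) {f : Eucl n → ℂ}
    (hf : Continuous f) (y : Eucl n) :
    Integrable (fun θ : Metric.sphere (0 : Eucl n) 1 =>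
      ((r y ^ (n - 1) : ℝ) : ℂ) * f (incidenceMap r (y, θ)).2)
      (volume : Measure (Eucl n)).toSphere := by
  refine integrable_sphere_of_continuous ?_
  have := continuous_incidenceMap hr
  fun_prop

lemma sphericalTransform_add (hr : Continuous r) (hpos : ∀ y, 0 < r y) {f g : Eucl n → ℂ}
    (hf : Continuous f) (hg : Continuous g) :
    sphericalTransform r (f + g) = sphericalTransform r f + sphericalTransform r g := by
  funext y
  rw [Pi.add_apply, sphericalTransform_eq_integral hpos (hf.add hg),
    sphericalTransform_eq_integral hpos hf, sphericalTransform_eq_integral hpos hg,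
    ← integral_add (integrable_sphericalTransform_integrand hr hf y)
      (integrable_sphericalTransform_integrand hr hg y)]
  simp only [Pi.add_apply, mul_add]

lemma sphericalTransform_smul (c : ℂ) (f : Eucl n → ℂ) :
    sphericalTransform r (c • f) = c • sphericalTransform r f := by
  funext y
  exact integral_smul c f

lemma integralAgainst_sphericalTransform_apply (hr : Continuous r) (hpos : ∀ y, 0 < r y)
    {f : Eucl n → ℂ} (hf : Continuous f) (g : 𝓓((⊤ : TopologicalSpace.Opens (Eucl n)), ℂ)) :
    (TestFunction.integralAgainstBilinCLM (ContinuousLinearMap.mul ℂ ℂ) volume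
      (sphericalTransform r f) : Distr (⊤ : TopologicalSpace.Opens (Eucl n))) g =
      ∫ y, sphericalTransform r f y * g y := by
  rw [TestFunction.integralAgainstBilinCLM_eq_integral
    ((continuous_sphericalTransform hr hpos hf).locallyIntegrable.locallyIntegrableOn _)]
  simp [mul_comm]

/-- The spherical transform as an operator `𝒟(ℝⁿ) → 𝒟'(ℝⁿ)`. -/
noncomputable def sphericalOperator (hr : Continuous r) (hpos : ∀ y, 0 < r y) :
    𝓓((⊤ : TopologicalSpace.Opens (Eucl n)), ℂ) →ₗ[ℂ]
      Distr (⊤ : TopologicalSpace.Opens (Eucl n)) where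
  toFun f := TestFunction.integralAgainstBilinCLM (ContinuousLinearMap.mul ℂ ℂ) volume
    (sphericalTransform r f)
  map_add' f₁ f₂ := by
    ext g
    have hi (f : 𝓓((⊤ : TopologicalSpace.Opens (Eucl n)), ℂ)) :
        Integrable fun y => sphericalTransform r f y * g y :=
      ((continuous_sphericalTransform hr hpos f.continuous).mul
        g.continuous).integrable_of_hasCompactSupport g.hasCompactSupport.mul_left
    rw [add_apply, integralAgainst_sphericalTransform_apply hr hpos (f₁ + f₂).continuous,
      integralAgainst_sphericalTransform_apply hr hpos f₁.continuous,
      integralAgainst_sphericalTransform_apply hr hpos f₂.continuous,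
      ← integral_add (hi f₁) (hi f₂)]
    refine integral_congr_ae (Eventually.of_forall fun y => ?_)
    simp only [FunLike.coe_add, sphericalTransform_add hr hpos f₁.continuous f₂.continuous,
      Pi.add_apply, add_mul]
  map_smul' c f := by
    ext g
    rw [RingHom.id_apply, smul_apply,
      integralAgainst_sphericalTransform_apply hr hpos (c • f).continuous,
      integralAgainst_sphericalTransform_apply hr hpos f.continuous, ← integral_smul]
    refine integral_congr_ae (Eventually.of_forall fun y => ?_)
    simp only [FunLike.coe_smul, sphericalTransform_smul, Pi.smul_apply, smul_mul_assoc]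

lemma sphericalOperator_apply (hr : Continuous r) (hpos : ∀ y, 0 < r y)
    (f g : 𝓓((⊤ : TopologicalSpace.Opens (Eucl n)), ℂ)) :
    sphericalOperator hr hpos f g = ∫ y, sphericalTransform r f y * g y :=
  integralAgainst_sphericalTransform_apply hr hpos f.continuous g

lemma isOperatorOf_sphericalOperator (hr : Continuous r) (hpos : ∀ y, 0 < r y) :
    IsOperatorOf (sphericalOperator hr hpos) (sphericalTransform r) := fun f =>
  ⟨(continuous_sphericalTransform hr hpos
    f.continuous).locallyIntegrable.locallyIntegrableOn _,
    fun g => sphericalOperator_apply hr hpos f g⟩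

lemma isFiniteMeasureOnCompacts_map_incidenceMap (hr : Continuous r) :
    IsFiniteMeasureOnCompacts ((centreDirectionMeasure n).map (incidenceMap r)) := by
  refine ⟨fun K hK => ?_⟩
  rw [Measure.map_apply (continuous_incidenceMap hr).measurable hK.measurableSet]
  refine (measure_mono (t := (Prod.fst '' K) ×ˢ univ) fun w hw => ?_).trans_lt ?_
  · exact ⟨⟨_, hw, rfl⟩, trivial⟩
  · rw [centreDirectionMeasure, Measure.prod_prod]
    exact ENNReal.mul_lt_top (hK.image continuous_fst).measure_lt_top (measure_lt_top _ _)

/-- The Schwartz kernel of the spherical transform: integration over the incidence relation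
`x ∈ S(y)` against `dS(x) dy`. -/
noncomputable def sphericalKernel (r : Eucl n → ℝ) :
    Distr (openProd (⊤ : TopologicalSpace.Opens (Eucl n)) (⊤ : TopologicalSpace.Opens (Eucl n))) :=
  TestFunction.integralAgainstBilinCLM (ContinuousLinearMap.mul ℂ ℂ)
    ((centreDirectionMeasure n).map (incidenceMap r)) fun q => ((r q.1 ^ (n - 1) : ℝ) : ℂ)

lemma sphericalKernel_apply (hr : Continuous r)
    (u : 𝓓(openProd (⊤ : TopologicalSpace.Opens (Eucl n))
      (⊤ : TopologicalSpace.Opens (Eucl n)), ℂ)) :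
    sphericalKernel r u = ∫ w, ((r w.1 ^ (n - 1) : ℝ) : ℂ) * u (incidenceMap r w)
      ∂centreDirectionMeasure n := by
  have := isFiniteMeasureOnCompacts_map_incidenceMap hr
  have hc : Continuous fun q : Eucl n × Eucl n => ((r q.1 ^ (n - 1) : ℝ) : ℂ) := by fun_prop
  refine (TestFunction.integralAgainstBilinCLM_eq_integral
    (hc.locallyIntegrable.locallyIntegrableOn _)).trans ?_
  rw [integral_map (continuous_incidenceMap hr).aemeasurable
    (f := fun q => ContinuousLinearMap.mul ℂ ℂ (u q) ((r q.1 ^ (n - 1) : ℝ) : ℂ))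
    (Continuous.aestronglyMeasurable
      (((ContinuousLinearMap.mul ℂ ℂ).continuous.comp u.continuous).clm_apply hc))]
  simp [mul_comm, incidenceMap]

/-- A function of `(y, θ)` that vanishes for `y` outside a compact set is compactly supported. -/
lemma hasCompactSupport_comp_incidenceMap {u : Eucl n × Eucl n → ℂ} (hu : HasCompactSupport u) :
    HasCompactSupport fun w => u (incidenceMap r w) := by
  refine HasCompactSupport.intro ((hu.isCompact.image continuous_fst).prod
    (isCompact_univ (X := Metric.sphere (0 : Eucl n) 1))) fun w hw => ?_
  by_contra h
  exact hw ⟨⟨_, subset_tsupport u h, rfl⟩, trivial⟩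

lemma isSchwartzKernel_sphericalKernel (hr : Continuous r) (hpos : ∀ y, 0 < r y) :
    IsSchwartzKernel (sphericalOperator hr hpos) (sphericalKernel r) := by
  intro f g
  rw [sphericalOperator_apply, sphericalKernel_apply hr, centreDirectionMeasure, integral_prod]
  · refine integral_congr_ae (Eventually.of_forall fun y => ?_)
    simp only
    rw [sphericalTransform_eq_integral hpos f.continuous, ← integral_mul_const]
    refine integral_congr_ae (Eventually.of_forall fun θ => ?_)
    change _ = _ * (g y * f _)
    simp only
    ring
  · refine Continuous.integrable_of_hasCompactSupport ?_
      (hasCompactSupport_comp_incidenceMap (tensor g f).hasCompactSupport).mul_left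
    have := (tensor g f).continuous.comp (continuous_incidenceMap hr)
    fun_prop

end Operator

/-! ### The symbol -/

section Symbol

variable {n : ℕ} {r : Eucl n → ℝ}

/-- The symbol `r(y) / π`. -/
noncomputable def sphericalSymbol (r : Eucl n → ℝ) (p : (Eucl n × Eucl n) × Eucl 1) : ℂ :=
  ((r p.1.1 / Real.pi : ℝ) : ℂ)

lemma isSymbol_sphericalSymbol (hr : ContDiff ℝ ∞ r) :
    IsSymbol ⊤ ⊤ 0 (sphericalSymbol r) := by
  have hc : ContDiff ℝ ∞ fun w : Eucl n × Eucl n => ((r w.1 / Real.pi : ℝ) : ℂ) :=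
    Complex.ofRealCLM.contDiff.comp ((hr.comp contDiff_fst).div_const _)
  refine ⟨(hc.comp contDiff_fst).contDiffOn, fun K hK _ j k => ?_⟩
  rcases k.eq_zero_or_pos with rfl | hk
  · obtain ⟨C, hC⟩ := hK.exists_bound_of_continuousOn
      (hc.continuous_iteratedFDeriv (m := j) (by exact_mod_cast le_top)).continuousOn
    refine ⟨C, fun z hz σ => ?_⟩
    have e : (fun w => iteratedFDeriv ℝ 0 (fun τ : Eucl 1 => sphericalSymbol r (w, τ)) σ) =
        (continuousMultilinearCurryFin0 ℝ (Eucl 1) ℂ).symm ∘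
          fun w : Eucl n × Eucl n => ((r w.1 / Real.pi : ℝ) : ℂ) := rfl
    rw [e, LinearIsometryEquiv.norm_iteratedFDeriv_comp_left]
    simpa using hC z hz
  · refine ⟨0, fun z _ σ => ?_⟩
    have e : (fun w => iteratedFDeriv ℝ k (fun τ : Eucl 1 => sphericalSymbol r (w, τ)) σ) =
        fun _ : Eucl n × Eucl n => 0 := by
      funext w
      have : (fun τ : Eucl 1 => sphericalSymbol r (w, τ)) =
        fun _ => ((r w.1 / Real.pi : ℝ) : ℂ) := rfl
      rw [this, iteratedFDeriv_const_of_ne hk.ne']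
      rfl
    rw [e]
    have : iteratedFDeriv ℝ j (fun _ : Eucl n × Eucl n =>
        (0 : ContinuousMultilinearMap ℝ (fun _ : Fin k => Eucl 1) ℂ)) = 0 :=
      iteratedFDeriv_fun_zero
    rw [this]
    simp

lemma isEllipticSymbol_sphericalSymbol (hr : Continuous r) (hpos : ∀ y, 0 < r y) :
    IsEllipticSymbol ⊤ ⊤ 0 (sphericalSymbol r) := by
  intro K hK _
  have hc : Continuous fun w : Eucl n × Eucl n => r w.1 / Real.pi := by fun_prop
  obtain ⟨C, hC, h⟩ : ∃ C > (0 : ℝ), ∀ z ∈ K, C ≤ r z.1 / Real.pi := by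
    rcases K.eq_empty_or_nonempty with rfl | hne
    · exact ⟨1, one_pos, by simp⟩
    · obtain ⟨z₀, -, h⟩ := hK.exists_isMinOn hne hc.continuousOn
      exact ⟨_, div_pos (hpos _) Real.pi_pos, h⟩
  refine ⟨C, hC, 1, one_pos, fun z hz σ _ => ?_⟩
  rw [Real.rpow_zero, mul_one, sphericalSymbol, Complex.norm_real]
  exact (h z hz).trans (le_abs_self _)

end Symbol

/-! ### The oscillatory integral -/

section Oscillatory

variable {n : ℕ} {r : Eucl n → ℝ} {χ : Eucl 1 → ℝ}

open FourierTransform in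
/-- The regularized `σ`-integral is an approximate identity in `|x - y|² - r(y)²`, here written
in polar coordinates `x = y + sθ`. -/
lemma regularized_oscillatoryIntegral [NeZero n] (hr : ContDiff ℝ ∞ r) (hχ : ContDiff ℝ ∞ χ)
    (hc : HasCompactSupport χ) {u : Eucl n × Eucl n → ℂ} (huc : Continuous u)
    (hu : HasCompactSupport u) {ε : ℝ} (hε : 0 < ε) :
    AEStronglyMeasurable (fun w : Eucl n × Metric.sphere (0 : Eucl n) 1 =>
      ∫ s in Ioi (0 : ℝ),
        ((s ^ (n - 1) : ℝ) * (r w.1 / Real.pi : ℝ) * u (w.1, w.1 + s • (w.2 : Eucl n)))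
        * ((ε⁻¹ : ℝ) * 𝓕 (cutoffSchwartz hχ hc) (-(s ^ 2 - r w.1 ^ 2) / (2 * Real.pi * ε))))
      (centreDirectionMeasure n) ∧
    ∫ p : (Eucl n × Eucl n) × Eucl 1, Complex.exp (Complex.I * (sphericalPhase r p : ℂ)) *
      sphericalSymbol r p * (χ (ε • p.2) : ℂ) * u p.1 =
    ∫ w : Eucl n × Metric.sphere (0 : Eucl n) 1, (∫ s in Ioi (0 : ℝ),
      ((s ^ (n - 1) : ℝ) * (r w.1 / Real.pi : ℝ) * u (w.1, w.1 + s • (w.2 : Eucl n)))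
        * ((ε⁻¹ : ℝ) * 𝓕 (cutoffSchwartz hχ hc) (-(s ^ 2 - r w.1 ^ 2) / (2 * Real.pi * ε))))
      ∂centreDirectionMeasure n := by
  set G : (Eucl n × Eucl n) × Eucl 1 → ℂ := fun p =>
    Complex.exp (Complex.I * (sphericalPhase r p : ℂ)) *
      sphericalSymbol r p * (χ (ε • p.2) : ℂ) * u p.1 with hG
  have hGi : Integrable G := by
    refine Continuous.integrable_of_hasCompactSupport ?_ ?_
    · have h1 := (contDiff_sphericalPhase hr).continuous
      have h2 := hr.continuous
      have h3 := hχ.continuous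
      unfold G sphericalSymbol
      fun_prop
    · refine HasCompactSupport.intro (hu.isCompact.prod (hc.isCompact.smul ε⁻¹)) fun p hp => ?_
      by_contra h
      refine hp ⟨subset_tsupport u (right_ne_zero_of_mul h), ?_⟩
      have h1 : χ (ε • p.2) ≠ 0 := by
        have := right_ne_zero_of_mul (left_ne_zero_of_mul h)
        exact_mod_cast this
      exact ⟨ε • p.2, subset_tsupport χ h1, inv_smul_smul₀ hε.ne' _⟩
  set F : Eucl n × Eucl n → ℂ := fun q => ((r q.1 / Real.pi : ℝ) : ℂ) * u q *
    ((ε⁻¹ : ℝ) * 𝓕 (cutoffSchwartz hχ hc) (-sphereDefect r q / (2 * Real.pi * ε))) with hF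
  have hFG : (fun q => ∫ σ, G (q, σ)) = F := by
    funext q
    simp only [hF]
    rw [← integral_cutoff_exp hχ hc hε, ← integral_const_mul]
    refine integral_congr_ae (Eventually.of_forall fun σ => ?_)
    simp only [hG, sphericalPhase_eq, sphericalSymbol]
    ring
  have hFi : Integrable F ((volume : Measure (Eucl n)).prod volume) := hFG ▸ hGi.integral_prod_left
  have hpt : ∀ w : Eucl n × Metric.sphere (0 : Eucl n) 1, ∀ s : ℝ,
      s ^ (Module.finrank ℝ (Eucl n) - 1) • F (w.1, w.1 + s • (w.2 : Eucl n)) =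
      ((s ^ (n - 1) : ℝ) * (r w.1 / Real.pi : ℝ) * u (w.1, w.1 + s • (w.2 : Eucl n)))
        * ((ε⁻¹ : ℝ) * 𝓕 (cutoffSchwartz hχ hc)
          (-(s ^ 2 - r w.1 ^ 2) / (2 * Real.pi * ε))) := by
    intro w s
    have h : sphereDefect r (w.1, w.1 + s • (w.2 : Eucl n)) = s ^ 2 - r w.1 ^ 2 := by
      simp [sphereDefect, norm_smul]
    simp only [hF, h, finrank_euclideanSpace_fin, Complex.real_smul]
    ring
  have h1 := integrable_radialIntegral volume hFi
  have h2 := integral_prod_eq_integral_radialIntegral volume hFi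
  simp only [hpt] at h1 h2
  refine ⟨h1.aestronglyMeasurable, ?_⟩
  rw [centreDirectionMeasure, ← h2, ← hFG]
  exact integral_prod _ hGi

theorem isOscillatoryIntegral_sphericalKernel [NeZero n] (hr : ContDiff ℝ ∞ r)
    (hpos : ∀ y, 0 < r y) :
    IsOscillatoryIntegral (sphericalPhase r) (sphericalSymbol r) (sphericalKernel r) := by
  intro χ hχ hc hχ1 u
  set φ := FourierTransform.fourier (cutoffSchwartz hχ hc) with hφ
  obtain ⟨C, hC⟩ := exists_schwartzMap_norm_le_inv_one_add_sq φ
  have hφ1 : ∫ x, φ x = 1 := by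
    rw [hφ, integral_fourier_cutoff, hχ1.self_of_nhds, Complex.ofReal_one]
  -- `|x - y| ^ (n - 1) u(y, x)` is bounded, being continuous with compact support.
  obtain ⟨M, hM⟩ : ∃ M, ∀ q : Eucl n × Eucl n, ‖((‖q.2 - q.1‖ ^ (n - 1) : ℝ) : ℂ) * u q‖ ≤ M := by
    refine Continuous.bounded_above_of_compact_support ?_ u.hasCompactSupport.mul_left
    have := u.continuous
    fun_prop
  set K : Set (Eucl n) := Prod.fst '' tsupport u with hK
  have hKc : IsCompact K := u.hasCompactSupport.isCompact.image continuous_fst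
  have hu0 : ∀ y ∉ K, ∀ x, u (y, x) = 0 := fun y hy x =>
    image_eq_zero_of_notMem_tsupport fun h => hy ⟨_, h, rfl⟩
  set H : Eucl n × Metric.sphere (0 : Eucl n) 1 → ℝ → ℂ := fun w s =>
    (s ^ (n - 1) : ℝ) * (r w.1 / Real.pi : ℝ) * u (w.1, w.1 + s • (w.2 : Eucl n)) with hH
  have hHb : ∀ w s, 0 < s → ‖H w s‖ ≤ r w.1 / Real.pi * M := by
    intro w s hs
    have h := hM (w.1, w.1 + s • (w.2 : Eucl n))
    simp only [add_sub_cancel_left, norm_smul, norm_eq_of_mem_sphere, mul_one,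
      Real.norm_of_nonneg hs.le] at h
    have e : H w s = ((r w.1 / Real.pi : ℝ) : ℂ) *
        (((s ^ (n - 1) : ℝ) : ℂ) * u (w.1, w.1 + s • (w.2 : Eucl n))) := by
      simp only [hH]; ring
    have hp : 0 ≤ r w.1 / Real.pi := div_nonneg (hpos _).le Real.pi_pos.le
    rw [e, norm_mul, Complex.norm_real, Real.norm_of_nonneg hp]
    exact mul_le_mul_of_nonneg_left h hp
  have hHc : ∀ w, Continuous (H w) := by
    intro w
    have := u.continuous
    simp only [hH]
    fun_prop
  set J : ℝ → Eucl n × Metric.sphere (0 : Eucl n) 1 → ℂ := fun ε w =>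
    ∫ s in Ioi (0 : ℝ), H w s *
      ((ε⁻¹ : ℝ) * φ (-(s ^ 2 - r w.1 ^ 2) / (2 * Real.pi * ε))) with hJ
  have hreg := fun (ε : ℝ) (hε : 0 < ε) =>
    regularized_oscillatoryIntegral hr hχ hc u.continuous u.hasCompactSupport hε
  have key : Tendsto (fun ε => ∫ w, J ε w ∂centreDirectionMeasure n) (𝓝[>] 0)
      (𝓝 (sphericalKernel r u)) := by
    rw [sphericalKernel_apply hr.continuous]
    refine tendsto_integral_filter_of_dominated_convergence
      ((K ×ˢ univ).indicator fun _ => 2 * Real.pi * M * C) ?_ ?_ ?_ ?_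
    · filter_upwards [self_mem_nhdsWithin] with ε hε
      exact (hreg ε hε).1
    · filter_upwards [self_mem_nhdsWithin] with ε hε
      refine Eventually.of_forall fun w => ?_
      by_cases hw : w.1 ∈ K
      · rw [indicator_of_mem (show w ∈ K ×ˢ univ from ⟨hw, trivial⟩)]
        refine (norm_radialIntegral_le hC (hpos w.1) hε (hHb w)).trans_eq ?_
        have := (hpos w.1).ne'
        field_simp
      · rw [indicator_of_notMem (fun h => hw h.1)]
        simp [hJ, hH, hu0 _ hw]
    · refine (integrable_indicator_iff (hKc.measurableSet.prod MeasurableSet.univ)).2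
        (integrableOn_const ?_)
      rw [centreDirectionMeasure, Measure.prod_prod]
      exact (ENNReal.mul_lt_top hKc.measure_lt_top (measure_lt_top _ _)).ne
    · refine Eventually.of_forall fun w => ?_
      have h := tendsto_radialIntegral φ.continuous hC hφ1 (hpos w.1) (hHc w) (hHb w)
      convert! h using 2
      have h1 : (r w.1 : ℂ) ≠ 0 := by exact_mod_cast (hpos w.1).ne'
      have h2 : (Real.pi : ℂ) ≠ 0 := by exact_mod_cast Real.pi_ne_zero
      simp only [hH, incidenceMap]
      push_cast
      field_simp
  refine key.congr' ?_
  filter_upwards [self_mem_nhdsWithin] with ε hε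
  exact (hreg ε hε).2.symm

end Oscillatory

end SphericalMicrolocal

open SphericalMicrolocal
theorem proposition3p1 (n : ℕ) [NeZero n] (r : Eucl n → ℝ) (hr : ContDiff ℝ ∞ r)
    (hpos : ∀ y, 0 < r y) (hgrad : ∀ y, ‖∇ r y‖ ≠ 1) :
    (∃ R : 𝓓((⊤ : TopologicalSpace.Opens (Eucl n)), ℂ) →ₗ[ℂ]
        Distr (⊤ : TopologicalSpace.Opens (Eucl n)),
      IsOperatorOf R (sphericalTransform r) ∧
        IsEllipticFIO R (sphericalPhase r) (-((n : ℝ) - 1) / 2)) ∧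
    IsGlobalParametrization (𝓘(ℝ, Eucl n).prod ((𝓡 (n - 1)).prod 𝓘(ℝ, ℝ)))
      (sphericalCoordinates r) (canonicalRelation ⊤ ⊤ (sphericalPhase r)) := by
  refine ⟨⟨sphericalOperator hr.continuous hpos, isOperatorOf_sphericalOperator hr.continuous hpos,
    0, sphericalSymbol r, ⟨one_pos, isCleanPhase_sphericalPhase hr hpos,
      isNondegenerate_sphericalPhase hr hpos hgrad, isSymbol_sphericalSymbol hr,
      sphericalKernel r, isSchwartzKernel_sphericalKernel hr.continuous hpos,
      isOscillatoryIntegral_sphericalKernel hr hpos⟩,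
    isEllipticSymbol_sphericalSymbol hr.continuous hpos, ?_⟩,
    isGlobalParametrization_sphericalCoordinates hr hpos⟩
  push_cast
  ring
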